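/- Let $n,d$ be positive integers. For $i,j\in\{1,\dots,n\}$ let $f_{ij}:\mathbb R\to\mathbb R$ be Lipschitz with $f_{ij}(s)>0$ for $s>0$. For each $i$ let $\mathcal N_i:\mathbb R\to 2^{\{1,\dots,n\}}$ be piecewise constant and right-continuous, and suppose that there is $\tau_D>0$ such that, for every $i$, any two distinct discontinuity times of $\mathcal N_i$ are more than $\tau_D$ apart. Suppose that the time-varying graph with edge set $\{(i,j): j\in\mathcal N_i(t)\}$ is uniformly quasi-strongly connected: there is $T>0$ such that, for every $t\in\mathbb R$, the union over $s\in[t,t+T)$ of the graphs at time $s$ has a node to which there is a directed path from every other node. Consider in $(\mathbb R^d)^n$ the lifted protocol $$\dot z_i=\sum_{j\in\mathcal N_i(t)} f_{ij}\left(\left\|\frac{z_j}{\|z_j\|}-\frac{z_i}{\|z_i\|}\right\|\right)\frac{\|z_i\|}{\|z_j\|}\,(z_j-z_i),\qquad i=1,\dots,n,\quad t\ge 0,$$ for states all of whose components are nonzero; solutions are continuous and satisfy the equation with the right derivative at every $t\ge0$. Let $w=(w_1,\dots,w_n)\in(\mathbb R^d)^n$, let $H(0,w)$ be the convex hull of $w_1,\dots,w_n$,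 and suppose $0\notin H(0,w)$. If $H(0,w)$ contains two distinct points that lie on a common ray from the origin, suppose moreover that $f_{ij}(0)>0$ for all $i\ne j$. Let $\mathcal A_z$ be the set of all $z\in (H(0,w))^n$ with $z_1=\dots=z_n$. Then every $z_0\in (H(0,w))^n$ is the initial state of a solution on $[0,\infty)$, and $\mathcal A_z$ is globally uniformly asymptotically stable relative to $(H(0,w))^n$, that is: - $(H(0,w))^n$ is compact and forward invariant: solutions with $z(0)\in (H(0,w))^n$ stay in it for all $t\ge 0$; - for every $\epsilon>0$ there is $T(\epsilon)>0$ such that $\operatorname{dist}(z(T(\epsilon)),\mathcal A_z)\le\epsilon$ for all solutions with $z(0)\in (H(0,w))^n$; - for every $\epsilon>0$ there is $\delta(\epsilon)>0$ such that all solutions with $z(0)\in (H(0,w))^n$ and $\operatorname{dist}(z(0),\mathcal A_z)\le\delta(\epsilon)$ satisfy $\operatorname{dist}(z(t),\mathcal A_z)\le\epsilon$ for all $t\ge0$. Moreover, for every solution with $z(0)\in (H(0,w))^n$ there is a point $\bar z\in\mathbb R^d$ such that $z_i(t)\to\bar z$ as $t\to\infty$ for all $i$. -/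

import Mathlib

open Set Filter Topology

/-- `ℝ^d` with its Euclidean norm. -/
abbrev Rd (d : ℕ) : Type := EuclideanSpace ℝ (Fin d)

/-- The state space `(ℝ^d)^n` of stacked vectors, with the Euclidean norm of `ℝ^(nd)`. -/
abbrev StateSpace (n d : ℕ) : Type := PiLp 2 (fun _ : Fin n => Rd d)

section Graphs

variable {n : ℕ}

/-- Time-varying neighborhoods `N i t`, `t ∈ ℝ`: each `N i` is right-continuous and piecewise
constant (the finite set of values being discrete), and there is `τ > 0` such that any two distinct
points of discontinuity of the same `N i` are more than `τ` apart. -/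
def HasDwellTime (N : Fin n → ℝ → Finset (Fin n)) : Prop :=
  (∀ i t, ∀ᶠ s in 𝓝[≥] t, N i s = N i t) ∧
    ∃ τ : ℝ, 0 < τ ∧ ∀ (i : Fin n) (s t : ℝ),
      ¬ (∀ᶠ r in 𝓝 s, N i r = N i s) → ¬ (∀ᶠ r in 𝓝 t, N i r = N i t) → s < t → τ < t - s

/-- There is an edge `(i, j)` in the union graph over `[t₁, t₂)` iff `j` is a neighbor of `i` at
some time in `[t₁, t₂)`. -/
def UnionEdge (N : Fin n → ℝ → Finset (Fin n)) (t₁ t₂ : ℝ) (i j : Fin n) : Prop :=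
  ∃ t ∈ Ico t₁ t₂, j ∈ N i t

/-- Some node `r` is such that from every node there is a directed path to `r`. -/
def QuasiStronglyConnected (E : Fin n → Fin n → Prop) : Prop :=
  ∃ r, ∀ i, Relation.ReflTransGen E i r

/-- The time-varying graph given by `N` is uniformly quasi-strongly connected. -/
def UniformlyQuasiStronglyConnected (N : Fin n → ℝ → Finset (Fin n)) : Prop :=
  ∃ T : ℝ, 0 < T ∧ ∀ t : ℝ, QuasiStronglyConnected (UnionEdge N t (t + T))

end Graphs

section Stability

variable {X : Type*} [PseudoMetricSpace X]

/-- `S` is forward invariant for the system whose solutions on `[0, ∞)` are the functions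
satisfying `Sol` (values at negative times play no role). -/
def ForwardInvariant (Sol : (ℝ → X) → Prop) (S : Set X) : Prop :=
  ∀ x, Sol x → x 0 ∈ S → ∀ t, 0 ≤ t → x t ∈ S

/-- `A` is globally uniformly asymptotically stable relative to the forward invariant compact
set `S`. -/
structure GloballyUniformlyAsymptoticallyStable (Sol : (ℝ → X) → Prop) (A S : Set X) : Prop where
  isCompact : IsCompact S
  forwardInvariant : ForwardInvariant Sol S
  attractive : ∀ ε : ℝ, 0 < ε → ∃ T : ℝ, 0 < T ∧
    ∀ x, Sol x → x 0 ∈ S → Metric.infDist (x T) A ≤ ε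
  stable : ∀ ε : ℝ, 0 < ε → ∃ δ : ℝ, 0 < δ ∧
    ∀ x, Sol x → x 0 ∈ S → Metric.infDist (x 0) A ≤ δ →
      ∀ t, 0 ≤ t → Metric.infDist (x t) A ≤ ε

end Stability

section Lifting

variable {n d : ℕ}

/-- The `i`-th component of the right-hand side of the lifted protocol. It is used only at states
whose components are all nonzero. -/
noncomputable def liftedField (f : Fin n → Fin n → ℝ → ℝ) (N : Fin n → ℝ → Finset (Fin n))
    (t : ℝ) (z : StateSpace n d) (i : Fin n) : Rd d :=
  ∑ j ∈ N i t,
    (f i j ‖(‖z j‖⁻¹ • z j - ‖z i‖⁻¹ • z i)‖ * (‖z i‖ / ‖z j‖)) • (z j - z i)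

/-- `z` is a solution on `[0, ∞)` of the lifted protocol: it is continuous, all components stay in
the domain `ℝ^d \ {0}` of the right-hand side, and the differential equation holds with the right
derivative at every time. (Since the neighborhoods are piecewise constant and right-continuous,
this says that the equation holds in the ordinary sense off the switching times.) -/
structure IsLiftedSolution (f : Fin n → Fin n → ℝ → ℝ) (N : Fin n → ℝ → Finset (Fin n))
    (z : ℝ → StateSpace n d) : Prop where
  continuousOn : ContinuousOn z (Ici 0)
  ne_zero : ∀ t, 0 ≤ t → ∀ i, z t i ≠ 0
  hasDeriv : ∀ t, 0 ≤ t → ∀ i,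
    HasDerivWithinAt (fun s => z s i) (liftedField f N t (z t) i) (Ici t) t

/-- The convex hull `H(0, w)` of the components of `w`. -/
def hull (w : StateSpace n d) : Set (Rd d) := convexHull ℝ (range fun i => w i)

/-- The set `(H(0, w))^n`. -/
def hullPower (w : StateSpace n d) : Set (StateSpace n d) := {z | ∀ i, z i ∈ hull w}

/-- The lifted consensus set: the points of `(H(0, w))^n` whose components are all equal. -/
def consensusSet (w : StateSpace n d) : Set (StateSpace n d) :=
  {z | z ∈ hullPower w ∧ ∀ i j, z i = z j}

end Lifting

/-!
Along a solution, the protocol is a linear averaging system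
`ż_i = ∑_{j ∈ N_i(t)} α_ij(t) (z_j - z_i)` with nonnegative weights `α_ij(t)`. By the maximum
principle (`IsAveragingFlow.le_of_le`) no linear functional of the components can exceed its initial
maximum, so every convex set containing all components stays invariant
(`IsAveragingFlow.mem_of_convex`). This gives forward invariance, and, applied to balls around
consensus values, stability.

Existence: on the compact convex set `hullPower w` the weights are Lipschitz, because the hull
avoids the origin. Their cut-off extensions define a bounded and globally Lipschitz field, switched
at times without accumulation point, which has global solutions by Picard–Lindelöf and concatenation.
Such a solution is again an averaging flow, hence never leaves the hull, where the extended weights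
are the original ones.

Attractivity reduces to one coordinate at a time. By compactness, the weight of an edge is at least
`c η > 0` while the values at its ends differ by at least `η` (`exists_le_liftedWeight`); if two
points of the hull lie on one ray, this is where `f i j 0 > 0` is needed. Let the values lie in
`[m, M]` at the beginning of a time window, and consider the nodes that are `δ` below `M` and those
that are `δ` above `m`. Each of the two sets persists through the window with a smaller `δ`, and is
joined by every node that has a neighbor in it (`exists_gap_propagation`). If `2 δ ≤ M - m`, the two
sets cover all nodes, so the root of the union graph is in one of them, and by connectivity this set
grows unless it is everything (`exists_gap_count`). Hence after `2 n + 1` windows one of them is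
everything, and `M - m` has dropped by an amount that depends only on a lower bound of `M - m`
(`exists_spread_decrease`). Uniform attractivity follows, and with the invariance of balls the
components converge to a common limit.
-/

/-! ### Averaging flows and the maximum principle -/

/-- The functions `y i : ℝ → E` form an averaging flow:
`ẏ_i = ∑_{j ∈ N_i(t)} α_ij(t) (y_j - y_i)` on `[0, ∞)` with the right derivative, where the
weights `α_ij(t)` are nonnegative. The weights are arbitrary functions of time; along a solution of
a nonlinear protocol they are obtained by evaluating the state-dependent weights. -/
structure IsAveragingFlow {n : ℕ} {E : Type*} [NormedAddCommGroup E] [NormedSpace ℝ E]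
    (N : Fin n → ℝ → Finset (Fin n)) (α : Fin n → Fin n → ℝ → ℝ) (y : Fin n → ℝ → E) : Prop where
  continuousOn : ∀ i, ContinuousOn (y i) (Ici 0)
  nonneg : ∀ i j t, 0 ≤ t → 0 ≤ α i j t
  hasDeriv : ∀ i t, 0 ≤ t →
    HasDerivWithinAt (y i) (∑ j ∈ N i t, α i j t • (y j t - y i t)) (Ici t) t

namespace IsAveragingFlow

variable {n : ℕ} {E : Type*} [NormedAddCommGroup E] [NormedSpace ℝ E]
  {N : Fin n → ℝ → Finset (Fin n)} {α : Fin n → Fin n → ℝ → ℝ}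

lemma map {F : Type*} [NormedAddCommGroup F] [NormedSpace ℝ F] {y : Fin n → ℝ → E}
    (h : IsAveragingFlow N α y) (φ : E →L[ℝ] F) :
    IsAveragingFlow N α (fun i t => φ (y i t)) where
  continuousOn i := φ.continuous.comp_continuousOn (h.continuousOn i)
  nonneg := h.nonneg
  hasDeriv i t ht := by
    have := φ.hasFDerivAt.comp_hasDerivWithinAt t (h.hasDeriv i t ht)
    simpa [map_sum, Function.comp_def] using this

lemma neg {y : Fin n → ℝ → ℝ} (h : IsAveragingFlow N α y) :
    IsAveragingFlow N α (fun i t => -y i t) := by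
  simpa using h.map (-ContinuousLinearMap.id ℝ ℝ)

/-- Maximum principle. -/
lemma le_of_le {y : Fin n → ℝ → ℝ} (h : IsAveragingFlow N α y) {s t M : ℝ} (hs : 0 ≤ s)
    (hst : s ≤ t) (hM : ∀ i, y i s ≤ M) (i : Fin n) : y i t ≤ M := by
  -- The strict barrier `M + ε (r - s)` cannot be crossed: where a maximal `y i` meets it, the
  -- right derivative of `y i` is at most `0 < ε`.
  have key : ∀ ε : ℝ, 0 < ε → ∀ r ∈ Icc s t, ∀ i, y i r ≤ M + ε * (r - s) := by
    intro ε hε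
    refine IsClosed.Icc_subset_of_forall_exists_gt
      (s := {r | ∀ i, y i r ≤ M + ε * (r - s)}) ?_ (by simpa using hM) ?_
    · have : {r | ∀ i, y i r ≤ M + ε * (r - s)} ∩ Icc s t =
          ⋂ i, {r ∈ Icc s t | y i r ≤ M + ε * (r - s)} ∩ Icc s t := by
        ext r
        simp only [mem_inter_iff, mem_ofPred_eq, mem_iInter]
        exact ⟨fun h i => ⟨⟨h.2, h.1 i⟩, h.2⟩, fun h => ⟨fun i => (h i).1.2, (h i).2⟩⟩
      rw [this]
      refine isClosed_iInter fun i => IsClosed.inter ?_ isClosed_Icc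
      exact isClosed_Icc.isClosed_le
        ((h.continuousOn i).mono fun r hr => hs.trans hr.1) (by fun_prop)
    · rintro r ⟨hr, hr1, hr2⟩ r' hr'
      have hr0 : 0 ≤ r := hs.trans hr1
      have hev : ∀ i, ∀ᶠ q in 𝓝[>] r, y i q ≤ M + ε * (q - s) := by
        intro i
        rcases (hr i).lt_or_eq with hlt | heq
        · have hc : ContinuousWithinAt (y i) (Ioi r) r :=
            (h.continuousOn i r hr0).mono fun q hq => hr0.trans (le_of_lt hq)
          have hc' : ContinuousWithinAt (fun q => M + ε * (q - s)) (Ioi r) r := by fun_prop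
          exact (hc.eventually_lt hc' hlt).mono fun q hq => hq.le
        · have hd : ∑ j ∈ N i r, α i j r • (y j r - y i r) ≤ 0 := by
            refine Finset.sum_nonpos fun j _ => ?_
            refine mul_nonpos_of_nonneg_of_nonpos (h.nonneg i j r hr0) ?_
            linarith [hr j]
          have hslope := hasDerivWithinAt_iff_tendsto_slope'
            (self_notMem_Ioi (a := r)) |>.1 ((h.hasDeriv i r hr0).mono Ioi_subset_Ici_self)
          filter_upwards [hslope.eventually_lt_const (hd.trans_lt hε), self_mem_nhdsWithin]
            with q hq hqr
          have hqr' : 0 < q - r := sub_pos.2 hqr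
          rw [slope_def_field, div_lt_iff₀ hqr'] at hq
          nlinarith
      obtain ⟨q, hq, hqr⟩ := ((eventually_all.2 hev).and (Ioc_mem_nhdsGT hr')).exists
      exact ⟨q, hq, hqr⟩
  refine le_of_forall_pos_le_add fun ε hε => ?_
  have h1 : 0 < t - s + 1 := by linarith
  have := key (ε / (t - s + 1)) (by positivity) t ⟨hst, le_rfl⟩ i
  have h2 : ε / (t - s + 1) * (t - s) ≤ ε := by
    rw [div_mul_eq_mul_div, div_le_iff₀ h1]; nlinarith
  linarith

lemma mem_convexHull {y : Fin n → ℝ → E} (h : IsAveragingFlow N α y) {s t : ℝ} (hs : 0 ≤ s)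
    (hst : s ≤ t) (i : Fin n) : y i t ∈ convexHull ℝ (range fun j => y j s) := by
  by_contra hi
  have hcl : IsClosed (convexHull ℝ (range fun j => y j s)) :=
    ((finite_range _).isCompact_convexHull ℝ).isClosed
  obtain ⟨φ, u, h1, h2⟩ := geometric_hahn_banach_closed_point (convex_convexHull ℝ _) hcl hi
  have := (h.map φ).le_of_le hs hst (M := u)
    (fun j => (h1 _ (subset_convexHull ℝ _ (mem_range_self j))).le) i
  linarith

lemma mem_of_convex {y : Fin n → ℝ → E} (h : IsAveragingFlow N α y) {K : Set E}
    (hK : Convex ℝ K) {s t : ℝ} (hs : 0 ≤ s) (hst : s ≤ t) (hy : ∀ i, y i s ∈ K) (i : Fin n) :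
    y i t ∈ K :=
  convexHull_min (range_subset_iff.2 hy) hK (h.mem_convexHull hs hst i)

end IsAveragingFlow

/-! ### Dwell time -/

/-- A function that is locally constant on `(a, b)` and right-continuous at `a` (with respect to the
discrete topology on its values) is constant on `[a, b)`. -/
lemma eq_left_of_eventually_eq {X : Type*} {g : ℝ → X} {a b : ℝ}
    (hr : ∀ᶠ r in 𝓝[≥] a, g r = g a) (h : ∀ t ∈ Ioo a b, ∀ᶠ r in 𝓝 t, g r = g t)
    {t : ℝ} (ht : t ∈ Ico a b) : g t = g a := by
  refine (isPreconnected_Ico (a := a) (b := b)).induction₂ (fun x y => g y = g x) ?_ ?_ ?_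
    ⟨le_rfl, ht.1.trans_lt ht.2⟩ ht
  · intro x hx
    rcases hx.1.eq_or_lt with rfl | hlt
    · exact hr.filter_mono (nhdsWithin_mono _ Ico_subset_Ici_self)
    · exact (h x ⟨hlt, hx.2⟩).filter_mono nhdsWithin_le_nhds
  · intro x y z _ _ _ h1 h2; exact h2.trans h1
  · intro x y _ _ h1; exact h1.symm

section DwellTime

variable {X : Type*} {g : ℝ → X} {τ : ℝ}

/-- If the discontinuities of `g` are more than `τ` apart, every value `g s` persists on an interval
of length `τ / 2` that begins or ends near `s`: if no discontinuity follows within `τ / 2`, the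
interval `[s, s + τ / 2)` works, and otherwise none precedes within `τ / 2`. -/
lemma exists_Ico_eq_of_dwell (hτ : 0 < τ) (hr : ∀ t, ∀ᶠ s in 𝓝[≥] t, g s = g t)
    (h : ∀ s t : ℝ, ¬ (∀ᶠ r in 𝓝 s, g r = g s) → ¬ (∀ᶠ r in 𝓝 t, g r = g t) → s < t → τ < t - s)
    (s : ℝ) : ∃ p, s - τ / 2 ≤ p ∧ p ≤ s ∧ ∀ t ∈ Ico p (p + τ / 2), g t = g s := by
  by_cases hd : ∀ t ∈ Ioo s (s + τ / 2), ∀ᶠ r in 𝓝 t, g r = g t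
  · exact ⟨s, by linarith, le_rfl, fun t ht => eq_left_of_eventually_eq (hr s) hd ht⟩
  · push Not at hd
    obtain ⟨q, hq, hqd⟩ := hd
    have hc : ∀ t ∈ Ioo (s - τ / 2) q, ∀ᶠ r in 𝓝 t, g r = g t := by
      intro t ht
      by_contra hcon
      have := h t q hcon (by simpa using hqd) ht.2
      linarith [ht.1, hq.2]
    have hall : ∀ t ∈ Ico (s - τ / 2) q, g t = g (s - τ / 2) :=
      fun t ht => eq_left_of_eventually_eq (hr _) hc ht
    refine ⟨s - τ / 2, le_rfl, by linarith, fun t ht => ?_⟩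
    rw [hall t ⟨ht.1, by linarith [ht.2, hq.1]⟩, hall s ⟨by linarith, hq.1⟩]

lemma exists_eventually_nhdsLT_eq_of_dwell (hτ : 0 < τ) (hr : ∀ t, ∀ᶠ s in 𝓝[≥] t, g s = g t)
    (h : ∀ s t : ℝ, ¬ (∀ᶠ r in 𝓝 s, g r = g s) → ¬ (∀ᶠ r in 𝓝 t, g r = g t) → s < t → τ < t - s)
    (t : ℝ) : ∃ v, ∀ᶠ s in 𝓝[<] t, g s = v := by
  have : ∃ p < t, ∀ q ∈ Ioo p t, ∀ᶠ r in 𝓝 q, g r = g q := by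
    by_cases hd : ∀ q ∈ Ioo (t - τ) t, ∀ᶠ r in 𝓝 q, g r = g q
    · exact ⟨t - τ, by linarith, hd⟩
    · push Not at hd
      obtain ⟨p, hp, hpd⟩ := hd
      refine ⟨p, hp.2, fun q hq => ?_⟩
      by_contra hcon
      have := h p q (by simpa using hpd) hcon hq.1
      linarith [hp.1, hq.2]
  obtain ⟨p, hp, hc⟩ := this
  refine ⟨g ((p + t) / 2), ?_⟩
  filter_upwards [Ico_mem_nhdsLT (show (p + t) / 2 < t by linarith)] with s hs
  exact eq_left_of_eventually_eq (hr _)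
    (fun q hq => hc q ⟨by linarith [hq.1], hq.2⟩) hs

end DwellTime

/-! ### Contraction of scalar averaging flows -/

/-- A scalar averaging flow whose weights are at most `C`, and at least `c η` as long as the two
values involved differ by at least `η`. Nothing is required where the values coincide: there the
weights may degenerate. -/
structure IsNondegenerateFlow {n : ℕ} (N : Fin n → ℝ → Finset (Fin n)) (C : ℝ) (c : ℝ → ℝ)
    (α : Fin n → Fin n → ℝ → ℝ) (y : Fin n → ℝ → ℝ) : Prop extends IsAveragingFlow N α y where
  le_bound : ∀ i j t, 0 ≤ t → α i j t ≤ C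
  lower : ∀ η, 0 < η → ∀ i j t, 0 ≤ t → η ≤ |y j t - y i t| → c η ≤ α i j t

namespace IsNondegenerateFlow

variable {n : ℕ} {N : Fin n → ℝ → Finset (Fin n)} {C : ℝ} {c : ℝ → ℝ}
  {α : Fin n → Fin n → ℝ → ℝ} {y : Fin n → ℝ → ℝ}

lemma neg (h : IsNondegenerateFlow N C c α y) :
    IsNondegenerateFlow N C c α (fun i t => -y i t) where
  toIsAveragingFlow := h.toIsAveragingFlow.neg
  le_bound := h.le_bound
  lower η hη i j t ht hd := h.lower η hη i j t ht (by
    rwa [← abs_neg, show -(y j t - y i t) = -y j t - -y i t by ring])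

/-- The value of a node approaches an upper bound `M` of all values at most exponentially. -/
lemma gap_ge (h : IsNondegenerateFlow N C c α y) (hC : 0 ≤ C) {s t M : ℝ} (hs : 0 ≤ s)
    (hst : s ≤ t) (hM : ∀ i, y i s ≤ M) (i : Fin n) :
    (M - y i s) * Real.exp (-(n * C * (t - s))) ≤ M - y i t := by
  -- `r ↦ (y i r - M) exp (n C (r - s))` is nonincreasing
  have hd : ∀ r ∈ Ico s t, HasDerivWithinAt
      (fun r => (y i r - M) * Real.exp (n * C * (r - s)))
      ((∑ j ∈ N i r, α i j r • (y j r - y i r)) * Real.exp (n * C * (r - s)) +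
        (y i r - M) * (Real.exp (n * C * (r - s)) * (n * C))) (Ici r) r := by
    intro r hr
    have h1 := (h.hasDeriv i r (hs.trans hr.1)).sub_const M
    have h2 : HasDerivAt (fun r => Real.exp (n * C * (r - s)))
        (Real.exp (n * C * (r - s)) * (n * C)) r := by
      have := (((hasDerivAt_id r).sub_const s).const_mul (n * C)).exp
      simpa using this
    exact h1.mul h2.hasDerivWithinAt
  have hcont : ContinuousOn (fun r => (y i r - M) * Real.exp (n * C * (r - s))) (Icc s t) :=
    (((h.continuousOn i).mono fun r hr => hs.trans hr.1).sub continuousOn_const).mul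
      (by fun_prop)
  have key := image_le_of_deriv_right_le_deriv_boundary hcont hd (B := fun _ => y i s - M)
    (B' := fun _ => 0) (by simp) continuousOn_const (fun r _ => hasDerivWithinAt_const _ _ _) (by
      intro r hr
      have hr0 := hs.trans hr.1
      have hMr := h.le_of_le hs hr.1 hM
      have hsum : ∑ j ∈ N i r, α i j r • (y j r - y i r) ≤ n * C * (M - y i r) := by
        calc ∑ j ∈ N i r, α i j r • (y j r - y i r) ≤ ∑ _j ∈ N i r, C * (M - y i r) := by
              refine Finset.sum_le_sum fun j _ => ?_
              rw [smul_eq_mul]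
              refine (mul_le_mul_of_nonneg_left (by linarith [hMr j] :
                y j r - y i r ≤ M - y i r) (h.nonneg i j r hr0)).trans ?_
              exact mul_le_mul_of_nonneg_right (h.le_bound i j r hr0) (by linarith [hMr i])
          _ = (N i r).card * (C * (M - y i r)) := by simp
          _ ≤ n * (C * (M - y i r)) := by
              refine mul_le_mul_of_nonneg_right ?_ (mul_nonneg hC (by linarith [hMr i]))
              exact_mod_cast (Finset.card_le_univ (N i r)).trans_eq (Fintype.card_fin n)
          _ = n * C * (M - y i r) := by ring
      have he := Real.exp_pos (n * C * (r - s))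
      nlinarith) (⟨hst, le_rfl⟩ : t ∈ Icc s t)
  have he := Real.exp_pos (-(n * C * (t - s)))
  have hee : Real.exp (n * C * (t - s)) * Real.exp (-(n * C * (t - s))) = 1 := by
    rw [← Real.exp_add]; simp
  have := mul_le_mul_of_nonneg_right key he.le
  rw [mul_assoc, hee, mul_one] at this
  linarith

/-- A node `i` that has a neighbor `j` staying `2 * η` below the upper bound `M` during `[p, q]` is
itself `β` below `M` at some time in `[p, q]`, for a suitably small `β`: otherwise the drift towards
`j` would exceed what the other neighbors can compensate. -/
lemma exists_gap_ge (h : IsNondegenerateFlow N C c α y) (hC : 0 ≤ C) {p q M η β : ℝ}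
    (hp : 0 ≤ p) (hpq : p < q) (hM : ∀ i, y i p ≤ M) {i j : Fin n}
    (hj : ∀ r ∈ Ico p q, j ∈ N i r) (hη : 0 < η) (hgap : ∀ r ∈ Icc p q, 2 * η ≤ M - y j r)
    (hcη : 0 ≤ c η) (hβη : β ≤ η) (hβ : n * C * β ≤ c η * η / 2)
    (hβt : β ≤ c η * η / 2 * (q - p)) :
    ∃ r ∈ Icc p q, β ≤ M - y i r := by
  by_contra! hcon
  have key := image_le_of_deriv_right_le_deriv_boundary
    ((h.continuousOn i).mono fun r (hr : r ∈ Icc p q) => hp.trans hr.1)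
    (fun r hr => h.hasDeriv i r (hp.trans hr.1))
    (B := fun r => y i p - c η * η / 2 * (r - p)) (B' := fun _ => - (c η * η / 2)) (by simp)
    (by fun_prop) (fun r _ => by
      have := ((((hasDerivAt_id r).sub_const p).const_mul (c η * η / 2)).const_sub (y i p))
      simpa using this.hasDerivWithinAt) (by
      intro r hr
      have hr0 := hp.trans hr.1
      have hMr := h.le_of_le hp hr.1 hM
      have hir := hcon r (Ico_subset_Icc_self hr)
      have hjr := hgap r (Ico_subset_Icc_self hr)
      have hjle : y j r - y i r ≤ -η := by linarith
      have hw : c η ≤ α i j r := h.lower η hη i j r hr0 (by rw [abs_of_nonpos] <;> linarith)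
      have hβ0 : 0 ≤ β := by linarith [hMr i]
      rw [← Finset.add_sum_erase _ _ (hj r hr)]
      have h1 : α i j r • (y j r - y i r) ≤ -(c η * η) := by
        rw [smul_eq_mul]; nlinarith
      have h2 : ∑ k ∈ (N i r).erase j, α i k r • (y k r - y i r) ≤ n * C * β := by
        calc ∑ k ∈ (N i r).erase j, α i k r • (y k r - y i r)
            ≤ ∑ _k ∈ (N i r).erase j, C * β := by
              refine Finset.sum_le_sum fun k _ => ?_
              rw [smul_eq_mul]
              refine (mul_le_mul_of_nonneg_left (by linarith [hMr k] :
                y k r - y i r ≤ β) (h.nonneg i k r hr0)).trans ?_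
              exact mul_le_mul_of_nonneg_right (h.le_bound i k r hr0) hβ0
          _ = ((N i r).erase j).card * (C * β) := by simp
          _ ≤ n * (C * β) := by
              refine mul_le_mul_of_nonneg_right ?_ (mul_nonneg hC hβ0)
              exact_mod_cast (Finset.card_le_univ _).trans_eq (Fintype.card_fin n)
          _ = n * C * β := by ring
      linarith) (right_mem_Icc.2 hpq.le)
  have h1 := hcon q (right_mem_Icc.2 hpq.le)
  have h2 := hM i
  linarith

end IsNondegenerateFlow

/-- The windows have length `T + 2 * τ`: the union graph is taken over an interval of length `T`,
padded by `τ` on both sides so that each of its edges is active during `τ / 2` within the window. A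
gap `δ` to an upper bound at the beginning of a window gives a gap `δ'` at its end, for the same
node and for every node that sees it in the union graph. The number `δ'` does not depend on the
flow or on the window. -/
lemma exists_gap_propagation {n : ℕ} {N : Fin n → ℝ → Finset (Fin n)} {C τ T : ℝ} {c : ℝ → ℝ}
    (hC : 0 ≤ C) (hc : ∀ η, 0 < η → 0 < c η) (hτ : 0 < τ) (hT : 0 < T)
    (hdwell : ∀ i s, ∃ p, s - τ / 2 ≤ p ∧ p ≤ s ∧ ∀ t ∈ Ico p (p + τ / 2), N i t = N i s)
    {δ : ℝ} (hδ : 0 < δ) :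
    ∃ δ', 0 < δ' ∧ δ' ≤ δ ∧ ∀ {α : Fin n → Fin n → ℝ → ℝ} {y : Fin n → ℝ → ℝ},
      IsNondegenerateFlow N C c α y → ∀ {s M : ℝ}, 0 ≤ s → (∀ i, y i s ≤ M) →
      ∀ j, y j s ≤ M - δ → y j (s + (T + 2 * τ)) ≤ M - δ' ∧
        ∀ i, UnionEdge N (s + τ) (s + τ + T) i j → y i (s + (T + 2 * τ)) ≤ M - δ' := by
  set κ := Real.exp (-(n * C * (T + 2 * τ))) with hκ
  have hκ0 : 0 < κ := Real.exp_pos _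
  have hκ1 : κ ≤ 1 := Real.exp_le_one_iff.2 (by
    have : 0 ≤ n * C * (T + 2 * τ) := by positivity
    linarith)
  have hmono : ∀ r, r ≤ T + 2 * τ → κ ≤ Real.exp (-(n * C * r)) := fun r hr => by
    refine Real.exp_le_exp.2 (neg_le_neg ?_)
    exact mul_le_mul_of_nonneg_left hr (by positivity)
  set η := δ * κ / 2 with hη
  have hη0 : 0 < η := by positivity
  have hcη := hc η hη0
  set K := (n : ℝ) * C + 1 with hK
  have hK0 : 0 < K := by positivity
  set β := min η (min (c η * η / 2 / K) (c η * η / 2 * (τ / 2))) with hβ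
  have hβ0 : 0 < β := by positivity
  have hβ1 : β ≤ η := min_le_left _ _
  have hβ2 : n * C * β ≤ c η * η / 2 := by
    have h1 : β ≤ c η * η / 2 / K := (min_le_right _ _).trans (min_le_left _ _)
    rw [le_div_iff₀ hK0] at h1
    nlinarith
  have hβ3 : β ≤ c η * η / 2 * (τ / 2) := (min_le_right _ _).trans (min_le_right _ _)
  have hβδ : β * κ ≤ δ * κ := by
    refine mul_le_mul_of_nonneg_right (hβ1.trans ?_) hκ0.le
    rw [hη]; nlinarith
  refine ⟨β * κ, by positivity, hβδ.trans (by nlinarith), ?_⟩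
  intro α y h s M hs hM j hj
  have hjgap : ∀ r ∈ Icc s (s + (T + 2 * τ)), δ * κ ≤ M - y j r := by
    intro r hr
    refine le_trans ?_ (h.gap_ge hC hs hr.1 hM j)
    exact mul_le_mul (by linarith) (hmono _ (by linarith [hr.2])) hκ0.le (by linarith)
  refine ⟨by linarith [hjgap _ ⟨by linarith, le_rfl⟩], ?_⟩
  rintro i ⟨t, ht, hjt⟩
  obtain ⟨p, hp1, hp2, hp⟩ := hdwell i t
  have hsp : s ≤ p := by linarith [ht.1]
  have hq : p + τ / 2 ≤ s + (T + 2 * τ) := by linarith [ht.2]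
  obtain ⟨r, hr, hgap⟩ := h.exists_gap_ge hC (hs.trans hsp) (by linarith : p < p + τ / 2)
    (h.le_of_le hs hsp hM) (fun r hr => by rw [hp r hr]; exact hjt) hη0
    (fun r hr => by
      have := hjgap r ⟨hsp.trans hr.1, hr.2.trans hq⟩
      linarith) hcη.le hβ1 hβ2 (by linarith)
  have hsr := hsp.trans hr.1
  have := h.gap_ge hC (hs.trans hsr) (hr.2.trans hq) (h.le_of_le hs hsr hM) i
  have h2 : β * κ ≤ (M - y i r) * Real.exp (-(n * C * (s + (T + 2 * τ) - r))) :=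
    mul_le_mul hgap (hmono _ (by linarith)) hκ0.le (hβ0.le.trans hgap)
  linarith

lemma exists_crossing_edge {V : Type*} {R : V → V → Prop} {a b : V}
    (h : Relation.ReflTransGen R a b) {A : Set V} (ha : a ∉ A) (hb : b ∈ A) :
    ∃ i j, R i j ∧ i ∉ A ∧ j ∈ A := by
  induction h with
  | refl => exact absurd hb ha
  | @tail b c _ hbc ih =>
    by_cases hbA : b ∈ A
    · exact ih hbA
    · exact ⟨b, c, hbc, hbA, hb⟩

/-- After `k` windows there is a gap `δ'` such that either all values are `δ'` below `M`, or all
are `δ'` above `m`, or the nodes `δ'` below `M` and those `δ'` above `m`, counted separately, number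
at least `k`. In each window the root of the union graph lies in one of the two sets (they cover all
nodes, because `2 * δ' ≤ M - m`), and this set gains a node. -/
lemma exists_gap_count {n : ℕ} {N : Fin n → ℝ → Finset (Fin n)} {C τ T : ℝ} {c : ℝ → ℝ}
    (hC : 0 ≤ C) (hc : ∀ η, 0 < η → 0 < c η) (hτ : 0 < τ) (hT : 0 < T)
    (hdwell : ∀ i s, ∃ p, s - τ / 2 ≤ p ∧ p ≤ s ∧ ∀ t ∈ Ico p (p + τ / 2), N i t = N i s)
    (hconn : ∀ t, QuasiStronglyConnected (UnionEdge N t (t + T)))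
    {ε : ℝ} (hε : 0 < ε) (k : ℕ) :
    ∃ δ', 0 < δ' ∧ 2 * δ' ≤ ε ∧ ∀ {α : Fin n → Fin n → ℝ → ℝ} {y : Fin n → ℝ → ℝ},
      IsNondegenerateFlow N C c α y → ∀ {s m M : ℝ}, 0 ≤ s → (∀ i, y i s ≤ M) →
      (∀ i, m ≤ y i s) → ε ≤ M - m →
      (∀ i, y i (s + k * (T + 2 * τ)) ≤ M - δ') ∨ (∀ i, m + δ' ≤ y i (s + k * (T + 2 * τ))) ∨
      k ≤ (Finset.univ.filter fun i => y i (s + k * (T + 2 * τ)) ≤ M - δ').card +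
        (Finset.univ.filter fun i => m + δ' ≤ y i (s + k * (T + 2 * τ))).card := by
  induction k with
  | zero => exact ⟨ε / 2, by positivity, by linarith, fun {_ _} _ {_ _ _} _ _ _ _ =>
      Or.inr (Or.inr (Nat.zero_le _))⟩
  | succ k ih =>
    obtain ⟨δ, hδ0, hδε, hδ⟩ := ih
    obtain ⟨δ', hδ'0, hδ'δ, hδ'⟩ := exists_gap_propagation (N := N) hC hc hτ hT hdwell hδ0
    refine ⟨δ', hδ'0, by linarith, fun {α y} h {s m M} hs hM hm hMm => ?_⟩
    set t := s + k * (T + 2 * τ) with ht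
    have hst : s ≤ t := by
      have : 0 ≤ k * (T + 2 * τ) := by positivity
      linarith
    have ht0 : 0 ≤ t := hs.trans hst
    have hMt := h.le_of_le hs hst hM
    have hmt := h.neg.le_of_le hs hst (M := -m) (fun i => by simpa using hm i)
    rw [show s + ((k + 1 : ℕ) : ℝ) * (T + 2 * τ) = t + (T + 2 * τ) by rw [ht]; push_cast; ring]
    have hup := hδ' h ht0 hMt
    have hdown : ∀ j, m + δ ≤ y j t → m + δ' ≤ y j (t + (T + 2 * τ)) ∧
        ∀ i, UnionEdge N (t + τ) (t + τ + T) i j → m + δ' ≤ y i (t + (T + 2 * τ)) := by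
      intro j hj
      obtain ⟨h1, h2⟩ := hδ' h.neg ht0 hmt j (by linarith)
      exact ⟨by linarith, fun i hi => by linarith [h2 i hi]⟩
    have hcases := hδ h hs hM hm hMm
    simp only [← ht] at hcases
    rcases hcases with hA | hB | hcard
    · exact Or.inl fun i => (hup i (hA i)).1
    · exact Or.inr (Or.inl fun i => (hdown i (hB i)).1)
    have hAsub : (Finset.univ.filter fun i => y i t ≤ M - δ) ⊆
        Finset.univ.filter fun i => y i (t + (T + 2 * τ)) ≤ M - δ' := fun i hi => by
      simp only [Finset.mem_filter, Finset.mem_univ, true_and] at hi ⊢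
      exact (hup i hi).1
    have hBsub : (Finset.univ.filter fun i => m + δ ≤ y i t) ⊆
        Finset.univ.filter fun i => m + δ' ≤ y i (t + (T + 2 * τ)) := fun i hi => by
      simp only [Finset.mem_filter, Finset.mem_univ, true_and] at hi ⊢
      exact (hdown i hi).1
    obtain ⟨r, hr⟩ := hconn (t + τ)
    by_cases hrA : y r t ≤ M - δ
    · by_cases hall : ∀ i, y i t ≤ M - δ
      · exact Or.inl fun i => (hup i (hall i)).1
      push Not at hall
      obtain ⟨i₀, hi₀⟩ := hall
      obtain ⟨i, j, hij, hi, hj⟩ := exists_crossing_edge (hr i₀)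
        (A := {i | y i t ≤ M - δ}) (by simpa using hi₀) hrA
      have hss : (Finset.univ.filter fun i => y i t ≤ M - δ) ⊂
          Finset.univ.filter fun i => y i (t + (T + 2 * τ)) ≤ M - δ' :=
        (Finset.ssubset_iff_of_subset hAsub).2
          ⟨i, by simpa using (hup j hj).2 i hij, by simpa using hi⟩
      have := Finset.card_lt_card hss
      have := Finset.card_le_card hBsub
      exact Or.inr (Or.inr (by omega))
    · have hrB : m + δ ≤ y r t := by push Not at hrA; linarith
      by_cases hall : ∀ i, m + δ ≤ y i t
      · exact Or.inr (Or.inl fun i => (hdown i (hall i)).1)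
      push Not at hall
      obtain ⟨i₀, hi₀⟩ := hall
      obtain ⟨i, j, hij, hi, hj⟩ := exists_crossing_edge (hr i₀)
        (A := {i | m + δ ≤ y i t}) (by simpa using hi₀) hrB
      have hss : (Finset.univ.filter fun i => m + δ ≤ y i t) ⊂
          Finset.univ.filter fun i => m + δ' ≤ y i (t + (T + 2 * τ)) :=
        (Finset.ssubset_iff_of_subset hBsub).2
          ⟨i, by simpa using (hdown j hj).2 i hij, by simpa using hi⟩
      have := Finset.card_lt_card hss
      have := Finset.card_le_card hAsub
      exact Or.inr (Or.inr (by omega))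

/-- Over a fixed time `H`, every spread of at least `ε` drops by a fixed amount `δ`. -/
lemma exists_spread_decrease {n : ℕ} {N : Fin n → ℝ → Finset (Fin n)} {C : ℝ} {c : ℝ → ℝ}
    (hC : 0 ≤ C) (hc : ∀ η, 0 < η → 0 < c η) (hN : HasDwellTime N)
    (hconn : UniformlyQuasiStronglyConnected N) {ε : ℝ} (hε : 0 < ε) :
    ∃ δ > 0, ∃ H > 0, ∀ {α : Fin n → Fin n → ℝ → ℝ} {y : Fin n → ℝ → ℝ},
      IsNondegenerateFlow N C c α y → ∀ {s m M : ℝ}, 0 ≤ s → (∀ i, y i s ∈ Icc m M) →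
      ε ≤ M - m → ∃ m' M', M' - m' ≤ M - m - δ ∧ ∀ i, y i (s + H) ∈ Icc m' M' := by
  obtain ⟨hNr, τ, hτ, hNd⟩ := hN
  obtain ⟨T, hT, hconn⟩ := hconn
  obtain ⟨δ, hδ0, hδε, hδ⟩ := exists_gap_count hC hc hτ hT
    (fun i => exists_Ico_eq_of_dwell hτ (hNr i) (hNd i)) hconn hε (2 * n + 1)
  have hH : 0 < ((2 * n + 1 : ℕ) : ℝ) * (T + 2 * τ) := by positivity
  refine ⟨δ, hδ0, ((2 * n + 1 : ℕ) : ℝ) * (T + 2 * τ), hH,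
    fun {α y} h {s m M} hs hy hMm => ?_⟩
  have hM' := h.le_of_le hs (le_add_of_nonneg_right hH.le) (fun i => (hy i).2)
  have hm' := h.neg.le_of_le hs (le_add_of_nonneg_right hH.le) (M := -m)
    (fun i => neg_le_neg (hy i).1)
  rcases hδ h hs (fun i => (hy i).2) (fun i => (hy i).1) hMm with h1 | h1 | h1
  · exact ⟨m, M - δ, by linarith, fun i => ⟨neg_le_neg_iff.1 (hm' i), h1 i⟩⟩
  · exact ⟨m + δ, M, by linarith, fun i => ⟨h1 i, hM' i⟩⟩
  · -- the two sets have at most `n` elements each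
    exfalso
    have hle : ∀ A : Finset (Fin n), A.card ≤ n := fun A =>
      (Finset.card_le_univ A).trans_eq (Fintype.card_fin n)
    have := h1.trans (add_le_add (hle _) (hle _))
    omega

/-- The time to reach a spread of `ε` depends only on the initial spread `D` and on the bounds on
the weights. -/
lemma exists_time_spread_le {n : ℕ} {N : Fin n → ℝ → Finset (Fin n)} {C : ℝ} {c : ℝ → ℝ}
    (hC : 0 ≤ C) (hc : ∀ η, 0 < η → 0 < c η) (hN : HasDwellTime N)
    (hconn : UniformlyQuasiStronglyConnected N) {ε : ℝ} (hε : 0 < ε) (D : ℝ) :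
    ∃ T > 0, ∀ {α : Fin n → Fin n → ℝ → ℝ} {y : Fin n → ℝ → ℝ},
      IsNondegenerateFlow N C c α y → (∀ i, y i 0 ∈ Icc (-D) D) → ∀ i j, |y i T - y j T| ≤ ε := by
  obtain ⟨δ, hδ, H, hH, hstep⟩ := exists_spread_decrease hC hc hN hconn hε
  have hiter : ∀ k : ℕ, ∀ {α : Fin n → Fin n → ℝ → ℝ} {y : Fin n → ℝ → ℝ},
      IsNondegenerateFlow N C c α y → (∀ i, y i 0 ∈ Icc (-D) D) →
      ∃ m M, M - m ≤ max ε (2 * D - k * δ) ∧ ∀ i, y i (k * H) ∈ Icc m M := by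
    intro k α y h hD
    induction k with
    | zero => exact ⟨-D, D, le_max_of_le_right (by push_cast; linarith), by simpa using hD⟩
    | succ k ih =>
      obtain ⟨m, M, hMm, hk⟩ := ih
      have hk0 : 0 ≤ (k : ℝ) * H := by positivity
      rw [show ((k + 1 : ℕ) : ℝ) * H = k * H + H by push_cast; ring]
      by_cases hlt : M - m ≤ ε
      · refine ⟨m, M, le_max_of_le_left hlt, fun i => ⟨?_, ?_⟩⟩
        · have := h.neg.le_of_le hk0 (le_add_of_nonneg_right hH.le) (M := -m)
            (fun i => neg_le_neg (hk i).1) i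
          linarith
        · exact h.le_of_le hk0 (le_add_of_nonneg_right hH.le) (fun i => (hk i).2) i
      · push Not at hlt
        obtain ⟨m', M', h1, h2⟩ := hstep h hk0 hk hlt.le
        refine ⟨m', M', le_max_of_le_right ?_, h2⟩
        rcases le_max_iff.1 hMm with h3 | h3
        · linarith
        · push_cast; linarith
  obtain ⟨k, hk⟩ := exists_nat_ge (2 * D / δ)
  rw [div_le_iff₀ hδ] at hk
  refine ⟨(k + 1 : ℕ) * H, by positivity, fun {α y} h hD i j => ?_⟩
  obtain ⟨m, M, hMm, hy⟩ := hiter (k + 1) h hD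
  rw [max_eq_left (by push_cast; linarith)] at hMm
  have hi := hy i
  have hj := hy j
  rw [abs_le]
  constructor <;> linarith [hi.1, hi.2, hj.1, hj.2]

/-! ### Global existence for switched Lipschitz fields -/

/-- `z` is continuous on `[a, b]` and satisfies `ż = v t z` there with the right derivative. -/
structure IsRightSolutionOn {E : Type*} [NormedAddCommGroup E] [NormedSpace ℝ E]
    (v : ℝ → E → E) (z : ℝ → E) (a b : ℝ) : Prop where
  continuousOn : ContinuousOn z (Icc a b)
  hasDeriv : ∀ t ∈ Ico a b, HasDerivWithinAt z (v t (z t)) (Ici t) t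

section Switched

open scoped NNReal

variable {E : Type*} [NormedAddCommGroup E] [NormedSpace ℝ E] {v : ℝ → E → E}

lemma IsRightSolutionOn.mono {z : ℝ → E} {a b c : ℝ} (h : IsRightSolutionOn v z a c)
    (hbc : b ≤ c) : IsRightSolutionOn v z a b where
  continuousOn := h.continuousOn.mono (Icc_subset_Icc_right hbc)
  hasDeriv t ht := h.hasDeriv t ⟨ht.1, ht.2.trans_le hbc⟩

lemma IsRightSolutionOn.congr {z z' : ℝ → E} {a b : ℝ} (h : IsRightSolutionOn v z a b)
    (hz : EqOn z' z (Icc a b)) : IsRightSolutionOn v z' a b where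
  continuousOn := h.continuousOn.congr hz
  hasDeriv t ht := by
    rw [hz (Ico_subset_Icc_self ht)]
    refine (h.hasDeriv t ht).congr_of_eventuallyEq ?_ (hz (Ico_subset_Icc_self ht))
    filter_upwards [Ico_mem_nhdsGE ht.2] with s hs using hz ⟨ht.1.trans hs.1, hs.2.le⟩

lemma IsRightSolutionOn.append {z : ℝ → E} {a b c : ℝ} (hab : a ≤ b) (hbc : b ≤ c)
    (h : IsRightSolutionOn v z a b) (h' : IsRightSolutionOn v z b c) :
    IsRightSolutionOn v z a c where
  continuousOn := by
    rw [← Icc_union_Icc_eq_Icc hab hbc]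
    exact h.continuousOn.union_of_isClosed h'.continuousOn isClosed_Icc isClosed_Icc
  hasDeriv t ht := by
    rcases lt_or_ge t b with htb | htb
    · exact h.hasDeriv t ⟨ht.1, htb⟩
    · exact h'.hasDeriv t ⟨htb, ht.2⟩

/-- From every initial value at time `a` there is a solution on `[a, b]`. -/
def IsSolvableOn (v : ℝ → E → E) (a b : ℝ) : Prop :=
  ∀ x : E, ∃ z : ℝ → E, z a = x ∧ IsRightSolutionOn v z a b

lemma IsSolvableOn.trans {a b c : ℝ} (hab : a ≤ b) (hbc : b ≤ c) (h : IsSolvableOn v a b)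
    (h' : IsSolvableOn v b c) : IsSolvableOn v a c := by
  intro x
  obtain ⟨z, hz, hsol⟩ := h x
  obtain ⟨z', hz', hsol'⟩ := h' (z b)
  have h1 : EqOn (fun t => if t ≤ b then z t else z' t) z (Icc a b) := fun t ht => by
    simp [ht.2]
  have h2 : EqOn (fun t => if t ≤ b then z t else z' t) z' (Icc b c) := fun t ht => by
    rcases ht.1.eq_or_lt with rfl | hlt
    · simp [hz']
    · simp [hlt.not_ge]
  exact ⟨_, by simp [hab, hz], (hsol.congr h1).append hab hbc (hsol'.congr h2)⟩

variable {K L : ℝ≥0}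

lemma isSolvableOn_of_eqOn [CompleteSpace E] (hK : ∀ t, LipschitzWith K (v t))
    (hL : ∀ t x, ‖v t x‖ ≤ L) {a b : ℝ} (hab : a ≤ b) (hv : ∀ t ∈ Ico a b, v t = v a) :
    IsSolvableOn v a b := by
  intro x
  have hPL : IsPicardLindelof (fun _ => v a) (⟨a, left_mem_Icc.2 hab⟩ : Icc a b) x
      (L * Real.toNNReal (b - a)) 0 L K :=
    { lipschitzOnWith := fun t _ => (hK a).lipschitzOnWith
      continuousOn := fun _ _ => continuousOn_const
      norm_le := fun _ _ y _ => hL a y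
      mul_max_le := by simp [hab] }
  obtain ⟨z, hz, hd⟩ := hPL.exists_eq_forall_mem_Icc_hasDerivWithinAt₀
  refine ⟨z, hz, fun t ht => (hd t ht).continuousWithinAt, fun t ht => ?_⟩
  rw [hv t ht]
  exact (hd t (Ico_subset_Icc_self ht)).mono_of_mem_nhdsWithin
    (mem_of_superset (Icc_mem_nhdsGE ht.2) (Icc_subset_Icc_left ht.1))

lemma isSolvableOn_of_switched [CompleteSpace E] (hK : ∀ t, LipschitzWith K (v t))
    (hL : ∀ t x, ‖v t x‖ ≤ L) (hr : ∀ t, ∀ᶠ s in 𝓝[≥] t, v s = v t)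
    (hl : ∀ t, ∃ u, ∀ᶠ s in 𝓝[<] t, v s = u) {a b : ℝ} (hab : a ≤ b) : IsSolvableOn v a b := by
  have hright : ∀ t, ∃ q > t, ∀ s ∈ Icc t q, IsSolvableOn v t s := by
    intro t
    obtain ⟨q, hq, hqs⟩ := mem_nhdsGE_iff_exists_Icc_subset.1 (hr t)
    exact ⟨q, hq, fun s hs => isSolvableOn_of_eqOn hK hL hs.1
      fun r hr => hqs ⟨hr.1, hr.2.le.trans hs.2⟩⟩
  have hleft : ∀ t, ∃ p < t, ∀ s ∈ Ioo p t, IsSolvableOn v s t := by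
    intro t
    obtain ⟨u, hu⟩ := hl t
    obtain ⟨p, hp, hps⟩ := mem_nhdsLT_iff_exists_Ioo_subset.1 hu
    exact ⟨p, hp, fun s hs => isSolvableOn_of_eqOn hK hL hs.2.le fun r hr =>
      (hps ⟨hs.1.trans_le hr.1, hr.2⟩).trans (hps hs).symm⟩
  -- the set of times up to which one can solve is closed and cannot end before `b`
  refine IsClosed.Icc_subset_of_forall_exists_gt (s := {t | IsSolvableOn v a t}) ?_ ?_ ?_
    (right_mem_Icc.2 hab)
  · refine isClosed_of_closure_subset fun t ht => ?_
    have htI : t ∈ Icc a b :=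
      isClosed_Icc.closure_subset (closure_mono inter_subset_right ht)
    refine ⟨?_, htI⟩
    obtain ⟨p, hp, hps⟩ := hleft t
    obtain ⟨s, hps', hs, hsI⟩ := mem_closure_iff_nhds.1 ht (Ioi p) (Ioi_mem_nhds hp)
    rcases lt_or_ge s t with hst | hst
    · exact IsSolvableOn.trans hsI.1 hst.le hs (hps s ⟨hps', hst⟩)
    · intro x
      obtain ⟨z, hz, hsol⟩ := hs x
      exact ⟨z, hz, hsol.mono hst⟩
  · exact isSolvableOn_of_eqOn hK hL le_rfl (by simp)
  · rintro t ⟨ht, htI⟩ r hr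
    obtain ⟨q, hq, hqs⟩ := hright t
    exact ⟨min q r, IsSolvableOn.trans htI.1 (le_min hq.le (le_of_lt hr)) ht
      (hqs _ ⟨le_min hq.le (le_of_lt hr), min_le_left _ _⟩), lt_min hq hr, min_le_right _ _⟩

/-- A bounded field, uniformly Lipschitz in the state and piecewise constant in time, has global
forward solutions. By uniqueness, the solutions on `[0, k]` agree where they overlap. -/
lemma exists_global_solution_of_switched [CompleteSpace E] (hK : ∀ t, LipschitzWith K (v t))
    (hL : ∀ t x, ‖v t x‖ ≤ L) (hr : ∀ t, ∀ᶠ s in 𝓝[≥] t, v s = v t)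
    (hl : ∀ t, ∃ u, ∀ᶠ s in 𝓝[<] t, v s = u) (x : E) :
    ∃ z : ℝ → E, z 0 = x ∧ ContinuousOn z (Ici 0) ∧
      ∀ t, 0 ≤ t → HasDerivWithinAt z (v t (z t)) (Ici t) t := by
  have hsolv : ∀ k : ℕ, ∃ z : ℝ → E, z 0 = x ∧ IsRightSolutionOn v z 0 k := fun k =>
    isSolvableOn_of_switched hK hL hr hl (Nat.cast_nonneg k) x
  choose φ hφ0 hφ using hsolv
  have huniq : ∀ k l : ℕ, k ≤ l → EqOn (φ l) (φ k) (Icc 0 k) := by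
    intro k l hkl
    have hl := (hφ l).mono (Nat.cast_le.2 hkl : (k : ℝ) ≤ l)
    exact ODE_solution_unique_of_mem_Icc_right (s := fun _ => univ)
      (fun t _ => (hK t).lipschitzOnWith) hl.continuousOn hl.hasDeriv (fun _ _ => mem_univ _)
      (hφ k).continuousOn (hφ k).hasDeriv (fun _ _ => mem_univ _) ((hφ0 l).trans (hφ0 k).symm)
  have hz : ∀ k : ℕ, EqOn (fun t => φ (⌊t⌋₊ + 1) t) (φ k) (Icc 0 k) := by
    intro k t ht
    have hlt : t ∈ Icc (0 : ℝ) (⌊t⌋₊ + 1 : ℕ) :=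
      ⟨ht.1, by push_cast; exact (Nat.lt_floor_add_one t).le⟩
    rcases le_total k (⌊t⌋₊ + 1) with h | h
    · exact huniq _ _ h ht
    · exact (huniq _ _ h hlt).symm
  have hsol : ∀ k : ℕ, IsRightSolutionOn v (fun t => φ (⌊t⌋₊ + 1) t) 0 k := fun k =>
    (hφ k).congr (hz k)
  refine ⟨fun t => φ (⌊t⌋₊ + 1) t, hφ0 _, fun t ht => ?_, fun t ht => ?_⟩
  · obtain ⟨k, hk⟩ := exists_nat_gt t
    refine ((hsol k).continuousOn t ⟨ht, hk.le⟩).mono_of_mem_nhdsWithin ?_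
    rw [← Ici_inter_Iic]
    exact inter_mem self_mem_nhdsWithin (mem_nhdsWithin_of_mem_nhds (Iic_mem_nhds hk))
  · obtain ⟨k, hk⟩ := exists_nat_gt t
    exact (hsol k).hasDeriv t ⟨ht, hk⟩

end Switched

/-! ### Lipschitz extension of the weights -/

section Extension

open scoped NNReal

lemma LipschitzOnWith.exists_mul_of_isCompact {X : Type*} [PseudoMetricSpace X] {s : Set X}
    (hs : IsCompact s) {f g : X → ℝ} {K L : ℝ≥0} (hf : LipschitzOnWith K f s)
    (hg : LipschitzOnWith L g s) : ∃ M, LipschitzOnWith M (fun x => f x * g x) s := by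
  obtain ⟨A, hA⟩ := hs.exists_bound_of_continuousOn hf.continuousOn
  obtain ⟨B, hB⟩ := hs.exists_bound_of_continuousOn hg.continuousOn
  refine ⟨Real.toNNReal (|A| * L + K * |B|), LipschitzOnWith.of_dist_le_mul fun x hx y hy => ?_⟩
  rw [Real.coe_toNNReal _ (by positivity)]
  have h1 := hf.dist_le_mul x hx y hy
  have h2 := hg.dist_le_mul x hx y hy
  rw [Real.dist_eq] at *
  calc |f x * g x - f y * g y| = |f x * (g x - g y) + (f x - f y) * g y| := by ring_nf
    _ ≤ |f x| * |g x - g y| + |f x - f y| * |g y| := by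
        rw [← abs_mul, ← abs_mul]; exact abs_add_le _ _
    _ ≤ |A| * (L * dist x y) + K * dist x y * |B| := by
        have h3 : |f x| ≤ |A| := (hA x hx).trans (le_abs_self A)
        have h4 : |g y| ≤ |B| := (hB y hy).trans (le_abs_self B)
        gcongr
    _ = (|A| * L + K * |B|) * dist x y := by ring

/-- A Lipschitz function with values in `[0, C]` on a bounded set extends to the whole space with
the same properties and bounded support. -/
lemma LipschitzOnWith.exists_extension_cutoff {E : Type*} [NormedAddCommGroup E] {s : Set E}
    {g : E → ℝ} {K : ℝ≥0} {C R : ℝ} (hg : LipschitzOnWith K g s) (hC : 0 ≤ C)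
    (h0 : ∀ x ∈ s, 0 ≤ g x) (h1 : ∀ x ∈ s, g x ≤ C) (hR : ∀ x ∈ s, ‖x‖ ≤ R) :
    ∃ b : E → ℝ, (∃ M, LipschitzWith M b) ∧ (∀ x, 0 ≤ b x) ∧ (∀ x, b x ≤ C) ∧ EqOn b g s ∧
      ∀ x, R + 1 ≤ ‖x‖ → b x = 0 := by
  obtain ⟨G, hG, hGg⟩ := hg.extend_real
  have hcut : LipschitzWith (Real.toNNReal C) fun x : E => C * (R + 1 - ‖x‖) := by
    refine LipschitzWith.of_dist_le_mul fun x y => ?_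
    rw [Real.coe_toNNReal _ hC, Real.dist_eq, ← mul_sub, abs_mul, abs_of_nonneg hC]
    refine mul_le_mul_of_nonneg_left ?_ hC
    rw [show R + 1 - ‖x‖ - (R + 1 - ‖y‖) = ‖y‖ - ‖x‖ by ring, dist_comm, dist_eq_norm]
    exact abs_norm_sub_norm_le y x
  refine ⟨fun x => max 0 (min C (min (G x) (C * (R + 1 - ‖x‖)))),
    ⟨_, ((hG.min hcut).const_min C).const_max 0⟩, fun x => le_max_left _ _,
    fun x => max_le hC (min_le_left _ _), fun x hx => ?_, fun x hx => ?_⟩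
  · have hCR : C ≤ C * (R + 1 - ‖x‖) := by nlinarith [hR x hx]
    have hgx := hGg hx
    simp only
    rw [← hgx, min_eq_left ((h1 x hx).trans hCR), min_eq_right (h1 x hx), max_eq_right (h0 x hx)]
  · refine max_eq_left ((min_le_right _ _).trans ((min_le_right _ _).trans ?_))
    nlinarith

/-- The product of a bounded Lipschitz function of bounded support with a linear map is Lipschitz
and bounded. -/
lemma LipschitzWith.smul_linear_of_cutoff {E F : Type*} [NormedAddCommGroup E] [NormedSpace ℝ E]
    [NormedAddCommGroup F] [NormedSpace ℝ F] {b : E → ℝ} {K : ℝ≥0} (hb : LipschitzWith K b)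
    {C R : ℝ} (hC : ∀ x, |b x| ≤ C) (hR : ∀ x, R ≤ ‖x‖ → b x = 0) (ℓ : E →L[ℝ] F) :
    (∃ M : ℝ≥0, LipschitzWith M fun x => b x • ℓ x) ∧ ∃ L : ℝ≥0, ∀ x, ‖b x • ℓ x‖ ≤ L := by
  have hC0 : 0 ≤ C := (abs_nonneg _).trans (hC 0)
  constructor
  · refine ⟨Real.toNNReal (K * (‖ℓ‖ * |R|) + C * ‖ℓ‖), LipschitzWith.of_dist_le_mul fun x y => ?_⟩
    rw [Real.coe_toNNReal _ (by positivity)]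
    -- the linear map is evaluated at `x`, which may be taken inside the support
    have key : ∀ x y : E, ‖x‖ < R → dist (b x • ℓ x) (b y • ℓ y) ≤
        (K * (‖ℓ‖ * |R|) + C * ‖ℓ‖) * dist x y := by
      intro x y hx
      have h1 : |b x - b y| ≤ K * dist x y := hb.dist_le_mul x y
      have h2 : ‖ℓ x‖ ≤ ‖ℓ‖ * |R| := (ℓ.le_opNorm x).trans
        (mul_le_mul_of_nonneg_left (hx.le.trans (le_abs_self R)) (norm_nonneg _))
      have h3 : ‖ℓ (x - y)‖ ≤ ‖ℓ‖ * dist x y := by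
        rw [dist_eq_norm]; exact ℓ.le_opNorm _
      rw [dist_eq_norm]
      calc ‖b x • ℓ x - b y • ℓ y‖ = ‖(b x - b y) • ℓ x + b y • ℓ (x - y)‖ := by
            rw [map_sub, sub_smul, smul_sub]; abel_nf
        _ ≤ |b x - b y| * ‖ℓ x‖ + |b y| * ‖ℓ (x - y)‖ := by
            refine (norm_add_le _ _).trans_eq ?_
            rw [norm_smul, norm_smul, Real.norm_eq_abs, Real.norm_eq_abs]
        _ ≤ K * dist x y * (‖ℓ‖ * |R|) + C * (‖ℓ‖ * dist x y) := by
            have := hC y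
            gcongr
        _ = _ := by ring
    rcases lt_or_ge ‖x‖ R with hx | hx
    · exact key x y hx
    rcases lt_or_ge ‖y‖ R with hy | hy
    · rw [dist_comm, dist_comm x y]; exact key y x hy
    · rw [hR x hx, hR y hy, zero_smul, zero_smul, dist_self]; positivity
  · refine ⟨Real.toNNReal (C * (‖ℓ‖ * |R|)), fun x => ?_⟩
    rw [Real.coe_toNNReal _ (by positivity)]
    rcases lt_or_ge ‖x‖ R with hx | hx
    · rw [norm_smul, Real.norm_eq_abs]
      exact mul_le_mul (hC x) ((ℓ.le_opNorm x).trans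
        (mul_le_mul_of_nonneg_left (hx.le.trans (le_abs_self R)) (norm_nonneg _)))
        (norm_nonneg _) hC0
    · rw [hR x hx, zero_smul, norm_zero]; positivity

lemma exists_lipschitz_bound_sum {E F : Type*} [NormedAddCommGroup E] [NormedAddCommGroup F]
    {ι : Type*} {g : ι → E → F}
    (h : ∀ i, (∃ M : ℝ≥0, LipschitzWith M (g i)) ∧ ∃ L : ℝ≥0, ∀ x, ‖g i x‖ ≤ L) (s : Finset ι) :
    (∃ M : ℝ≥0, LipschitzWith M fun x => ∑ i ∈ s, g i x) ∧
      ∃ L : ℝ≥0, ∀ x, ‖∑ i ∈ s, g i x‖ ≤ L := by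
  choose hM hL using h
  choose M hM using hM
  choose L hL using hL
  refine ⟨⟨∑ i ∈ s, M i, LipschitzWith.of_dist_le_mul fun x y => ?_⟩, ∑ i ∈ s, L i, fun x => ?_⟩
  · push_cast
    rw [Finset.sum_mul]
    exact (dist_sum_sum_le _ _ _).trans (Finset.sum_le_sum fun i _ => (hM i).dist_le_mul x y)
  · push_cast
    exact (norm_sum_le _ _).trans (Finset.sum_le_sum fun i _ => hL i x)

end Extension

/-! ### Existence for state-dependent weights -/

/-- The switched averaging system whose weights `b i j` are globally Lipschitz, bounded and of
bounded support has global solutions. -/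
lemma exists_averaging_solution {n d : ℕ} {N : Fin n → ℝ → Finset (Fin n)} (hN : HasDwellTime N)
    {b : Fin n → Fin n → StateSpace n d → ℝ} {C R : ℝ}
    (hlip : ∀ i j, ∃ M, LipschitzWith M (b i j)) (h0 : ∀ i j x, 0 ≤ b i j x)
    (hC : ∀ i j x, b i j x ≤ C) (hR : ∀ i j x, R ≤ ‖x‖ → b i j x = 0) (x : StateSpace n d) :
    ∃ z : ℝ → StateSpace n d, z 0 = x ∧ ContinuousOn z (Ici 0) ∧ ∀ t, 0 ≤ t → ∀ i,
      HasDerivWithinAt (fun s => z s i) (∑ j ∈ N i t, b i j (z t) • (z t j - z t i)) (Ici t) t := by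
  classical
  obtain ⟨hNr, τ, hτ, hNd⟩ := hN
  -- `e i` places a vector in the component `i`
  let e : Fin n → Rd d →L[ℝ] StateSpace n d := fun i =>
    (PiLp.continuousLinearEquiv 2 ℝ (fun _ : Fin n => Rd d)).symm.toContinuousLinearMap ∘L
      ContinuousLinearMap.single ℝ (fun _ : Fin n => Rd d) i
  let pr : Fin n → StateSpace n d →L[ℝ] Rd d := fun i => PiLp.proj 2 (fun _ : Fin n => Rd d) i
  have he : ∀ i k v, e i v k = if k = i then v else 0 := by
    intro i k v
    simp only [e, ContinuousLinearMap.comp_apply]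
    change (Pi.single i v : Fin n → Rd d) k = _
    rw [Pi.single_apply]
  let ℓ : Fin n → Fin n → StateSpace n d →L[ℝ] StateSpace n d := fun i j => e i ∘L (pr j - pr i)
  let G : (Fin n → Finset (Fin n)) → StateSpace n d → StateSpace n d := fun A z =>
    ∑ i, ∑ j ∈ A i, b i j z • ℓ i j z
  have hG : ∀ A, (∃ M, LipschitzWith M (G A)) ∧ ∃ L : NNReal, ∀ z, ‖G A z‖ ≤ L := fun A =>
    exists_lipschitz_bound_sum (fun i => exists_lipschitz_bound_sum (fun j => by
      obtain ⟨M, hM⟩ := hlip i j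
      exact hM.smul_linear_of_cutoff (fun x => by rw [abs_of_nonneg (h0 i j x)]; exact hC i j x)
        (hR i j) (ℓ i j)) _) _
  choose hM hL using hG
  choose M hM using hM
  choose L hL using hL
  obtain ⟨K, hK⟩ := Finite.exists_le M
  obtain ⟨B, hB⟩ := Finite.exists_le L
  obtain ⟨z, hz0, hzc, hzd⟩ := exists_global_solution_of_switched (v := fun t => G fun i => N i t)
    (K := K) (L := B) (fun t => (hM _).weaken (hK _))
    (fun t x => (hL _ x).trans (NNReal.coe_le_coe.2 (hB _)))
    (fun t => by
      filter_upwards [eventually_all.2 fun i => hNr i t] with s hs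
      rw [funext hs])
    (fun t => by
      choose u hu using fun i => exists_eventually_nhdsLT_eq_of_dwell hτ (hNr i) (hNd i) t
      refine ⟨G u, ?_⟩
      filter_upwards [eventually_all.2 hu] with s hs
      rw [funext hs]) x
  refine ⟨z, hz0, hzc, fun t ht i => ?_⟩
  have hcomp := (pr i).hasFDerivAt.comp_hasDerivWithinAt t (hzd t ht)
  refine hcomp.congr_deriv ?_
  have : ∀ k j, pr i (ℓ k j (z t)) = if i = k then z t j - z t k else 0 := fun k j => he k i _
  simp only [G, map_sum, map_smul, this, smul_ite, smul_zero]
  rw [Finset.sum_eq_single i (fun k _ hk => by simp [hk.symm]) (by simp)]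
  simp

/-! ### The weights of the lifted protocol on the hull -/

section Hull

variable {n d : ℕ} {w : StateSpace n d}

lemma isCompact_hull (w : StateSpace n d) : IsCompact (hull w) :=
  (finite_range _).isCompact_convexHull ℝ

lemma isCompact_hullPower (w : StateSpace n d) : IsCompact (hullPower w) := by
  have h : hullPower w = WithLp.toLp 2 '' (univ.pi fun _ : Fin n => hull w) := by
    ext z
    refine ⟨fun hz => ⟨WithLp.ofLp z, fun i _ => hz i, rfl⟩, ?_⟩
    rintro ⟨y, hy, rfl⟩ i
    exact hy i (mem_univ i)
  rw [h]
  exact (isCompact_univ_pi fun _ => isCompact_hull w).image (PiLp.continuous_toLp 2 _)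

lemma convex_hullPower (w : StateSpace n d) : Convex ℝ (hullPower w) :=
  fun _ hx _ hy _ _ ha hb hab i => convex_convexHull ℝ _ (hx i) (hy i) ha hb hab

lemma ne_zero_of_mem_hullPower (hw : (0 : Rd d) ∉ hull w) {z : StateSpace n d}
    (hz : z ∈ hullPower w) (i : Fin n) : z i ≠ 0 :=
  fun h => hw (h ▸ hz i)

end Hull

section Weights

variable {n d : ℕ}

/-- The weight `f_ij(‖z_j/‖z_j‖ - z_i/‖z_i‖‖) ‖z_i‖/‖z_j‖` of the edge `(i, j)` at the state `z`. -/
noncomputable def liftedWeight (f : Fin n → Fin n → ℝ → ℝ) (i j : Fin n) (z : StateSpace n d) : ℝ :=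
  f i j ‖(‖z j‖⁻¹ • z j - ‖z i‖⁻¹ • z i)‖ * (‖z i‖ / ‖z j‖)

variable {f : Fin n → Fin n → ℝ → ℝ} {w : StateSpace n d}

lemma liftedWeight_nonneg
    (hf_lip : ∀ i j, ∃ K, LipschitzWith K (f i j))
    (hf_pos : ∀ i j s, 0 < s → 0 < f i j s)
    (i j : Fin n) (z : StateSpace n d) : 0 ≤ liftedWeight f i j z := by
  have h : ∀ s, 0 ≤ s → 0 ≤ f i j s := by
    obtain ⟨K, hK⟩ := hf_lip i j
    intro s hs
    -- continuity gives the case `s = 0`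
    refine ge_of_tendsto (hK.continuous.continuousWithinAt (s := Ioi s)) ?_
    filter_upwards [self_mem_nhdsWithin] with r hr using (hf_pos i j r (hs.trans_lt hr)).le
  exact mul_nonneg (h _ (norm_nonneg _)) (by positivity)

lemma exists_lipschitzOnWith_liftedWeight
    (hf_lip : ∀ i j, ∃ K, LipschitzWith K (f i j))
    (hw : (0 : Rd d) ∉ hull w) (i j : Fin n) :
    ∃ K, LipschitzOnWith K (liftedWeight f i j) (hullPower w) := by
  have hc : ∀ k, ContDiffOn ℝ 1 (fun z : StateSpace n d => z k) (hullPower w) := fun k =>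
    (PiLp.proj 2 (𝕜 := ℝ) (fun _ : Fin n => Rd d) k).contDiff.contDiffOn
  have hnorm : ∀ k, ContDiffOn ℝ 1 (fun z : StateSpace n d => ‖z k‖) (hullPower w) := fun k =>
    (hc k).norm ℝ fun z hz => ne_zero_of_mem_hullPower hw hz k
  have hinv : ∀ k, ContDiffOn ℝ 1 (fun z : StateSpace n d => ‖z k‖⁻¹) (hullPower w) := fun k =>
    (hnorm k).inv fun z hz => norm_ne_zero_iff.2 (ne_zero_of_mem_hullPower hw hz k)
  have hdir := (((hinv j).smul (hc j)).sub ((hinv i).smul (hc i))).exists_lipschitzOnWith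
    one_ne_zero (convex_hullPower w) (isCompact_hullPower w)
  have hquot := ((hnorm i).div (hnorm j) fun z hz => norm_ne_zero_iff.2
    (ne_zero_of_mem_hullPower hw hz j)).exists_lipschitzOnWith one_ne_zero
    (convex_hullPower w) (isCompact_hullPower w)
  obtain ⟨K₁, h₁⟩ := hdir
  obtain ⟨K₂, h₂⟩ := hquot
  obtain ⟨K, hK⟩ := hf_lip i j
  have h₃ := (hK.comp lipschitzWith_one_norm).comp_lipschitzOnWith h₁
  exact h₃.exists_mul_of_isCompact (isCompact_hullPower w) h₂

lemma exists_liftedWeight_le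
    (hf_lip : ∀ i j, ∃ K, LipschitzWith K (f i j))
    (hw : (0 : Rd d) ∉ hull w) :
    ∃ C, 0 ≤ C ∧ ∀ i j, ∀ z ∈ hullPower w, liftedWeight f i j z ≤ C := by
  have h : ∀ p : Fin n × Fin n, ∃ C, ∀ z ∈ hullPower w, ‖liftedWeight f p.1 p.2 z‖ ≤ C :=
    fun p => by
      obtain ⟨K, hK⟩ := exists_lipschitzOnWith_liftedWeight hf_lip hw p.1 p.2
      exact (isCompact_hullPower w).exists_bound_of_continuousOn hK.continuousOn
  choose C hC using h
  obtain ⟨B, hB⟩ := Finite.exists_le C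
  exact ⟨max 0 B, le_max_left _ _, fun i j z hz => (le_abs_self _).trans
    ((hC (i, j) z hz).trans ((hB _).trans (le_max_right _ _)))⟩

lemma liftedWeight_pos
    (hf_pos : ∀ i j s, 0 < s → 0 < f i j s)
    (hw : (0 : Rd d) ∉ hull w)
    (hf_zero : (∃ a ∈ hull w, ∃ b ∈ hull w, a ≠ b ∧ SameRay ℝ a b) →
      ∀ i j, i ≠ j → 0 < f i j 0)
    {i j : Fin n} {z : StateSpace n d} (hz : z ∈ hullPower w) (hij : z i ≠ z j) :
    0 < liftedWeight f i j z := by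
  have hi := ne_zero_of_mem_hullPower hw hz i
  have hj := ne_zero_of_mem_hullPower hw hz j
  have hi' := norm_pos_iff.2 hi
  have hj' := norm_pos_iff.2 hj
  refine mul_pos ?_ (by positivity)
  by_cases h : ‖z j‖⁻¹ • z j - ‖z i‖⁻¹ • z i = 0
  · rw [h, norm_zero]
    refine hf_zero ⟨z i, hz i, z j, hz j, hij, ?_⟩ i j fun hne => hij (hne ▸ rfl)
    exact (sameRay_iff_inv_norm_smul_eq_of_ne hi hj).2 (sub_eq_zero.1 h).symm
  · exact hf_pos i j _ (norm_pos_iff.2 h)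

/-- By compactness, the weights are bounded below in terms of the distance of the two components. -/
lemma exists_le_liftedWeight
    (hf_lip : ∀ i j, ∃ K, LipschitzWith K (f i j))
    (hf_pos : ∀ i j s, 0 < s → 0 < f i j s)
    (hw : (0 : Rd d) ∉ hull w)
    (hf_zero : (∃ a ∈ hull w, ∃ b ∈ hull w, a ≠ b ∧ SameRay ℝ a b) →
      ∀ i j, i ≠ j → 0 < f i j 0) {η : ℝ} (hη : 0 < η) :
    ∃ c, 0 < c ∧ ∀ i j, ∀ z ∈ hullPower w, η ≤ ‖z j - z i‖ → c ≤ liftedWeight f i j z := by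
  have h : ∀ p : Fin n × Fin n, ∃ c : Ioi (0 : ℝ), ∀ z ∈ hullPower w, η ≤ ‖z p.2 - z p.1‖ →
      c ≤ liftedWeight f p.1 p.2 z := fun p => by
    obtain ⟨K, hK⟩ := exists_lipschitzOnWith_liftedWeight hf_lip hw p.1 p.2
    have hcl : IsClosed {z : StateSpace n d | η ≤ ‖z p.2 - z p.1‖} :=
      isClosed_le continuous_const (by fun_prop)
    obtain ⟨c, hc, hcle⟩ := ((isCompact_hullPower w).inter_right hcl).exists_forall_le'
      (hK.continuousOn.mono inter_subset_left) (a := 0) (fun z hz =>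
        liftedWeight_pos hf_pos hw hf_zero hz.1 fun h => by
          have h2 : η ≤ ‖z p.2 - z p.1‖ := hz.2
          rw [h, sub_self, norm_zero] at h2
          exact h2.not_gt hη)
    exact ⟨⟨c, hc⟩, fun z hz hd => hcle z ⟨hz, hd⟩⟩
  choose c hc using h
  obtain ⟨B, hB⟩ := Finite.exists_ge c
  exact ⟨B, B.2, fun i j z hz hd => (Subtype.coe_le_coe.2 (hB (i, j))).trans (hc (i, j) z hz hd)⟩

end Weights

/-! ### Solutions of the lifted protocol -/

section Solutions

variable {n d : ℕ} {f : Fin n → Fin n → ℝ → ℝ} {N : Fin n → ℝ → Finset (Fin n)}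
  {w : StateSpace n d}

lemma IsLiftedSolution.isAveragingFlow
    (hf_lip : ∀ i j, ∃ K, LipschitzWith K (f i j))
    (hf_pos : ∀ i j s, 0 < s → 0 < f i j s)
    {z : ℝ → StateSpace n d} (h : IsLiftedSolution f N z) :
    IsAveragingFlow N (fun i j t => liftedWeight f i j (z t)) (fun i t => z t i) where
  continuousOn i := (PiLp.continuous_apply 2 _ i).comp_continuousOn h.continuousOn
  nonneg i j t _ := liftedWeight_nonneg hf_lip hf_pos i j (z t)
  hasDeriv i t ht := h.hasDeriv t ht i

lemma forwardInvariant_hullPower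
    (hf_lip : ∀ i j, ∃ K, LipschitzWith K (f i j))
    (hf_pos : ∀ i j s, 0 < s → 0 < f i j s)
    (w : StateSpace n d) :
    ForwardInvariant (IsLiftedSolution f N) (hullPower w) := fun _ hz hz0 _ ht =>
  (hz.isAveragingFlow hf_lip hf_pos).mem_of_convex (convex_convexHull ℝ _) le_rfl ht hz0

/-- The extended weights agree with the weights of the protocol on the hull, which the averaging
flow does not leave. -/
lemma exists_isLiftedSolution
    (hf_lip : ∀ i j, ∃ K, LipschitzWith K (f i j))
    (hf_pos : ∀ i j s, 0 < s → 0 < f i j s)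
    (hN : HasDwellTime N) (hw : (0 : Rd d) ∉ hull w)
    {z₀ : StateSpace n d} (hz₀ : z₀ ∈ hullPower w) :
    ∃ z, IsLiftedSolution f N z ∧ z 0 = z₀ := by
  obtain ⟨C, hC0, hC⟩ := exists_liftedWeight_le hf_lip hw
  obtain ⟨R, hR⟩ := (isCompact_hullPower w).isBounded.exists_norm_le
  choose K hK using exists_lipschitzOnWith_liftedWeight hf_lip hw
  have hext := fun i j => (hK i j).exists_extension_cutoff hC0
    (fun z _ => liftedWeight_nonneg hf_lip hf_pos i j z) (hC i j) hR
  choose b hblip hb0 hbC hbeq hbR using hext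
  obtain ⟨z, hz0, hzc, hzd⟩ := exists_averaging_solution hN hblip hb0 hbC hbR z₀
  have hflow : IsAveragingFlow N (fun i j t => b i j (z t)) (fun i t => z t i) :=
    { continuousOn := fun i => (PiLp.continuous_apply 2 _ i).comp_continuousOn hzc
      nonneg := fun i j t _ => hb0 i j (z t)
      hasDeriv := fun i t ht => hzd t ht i }
  have hmem : ∀ t, 0 ≤ t → z t ∈ hullPower w := fun t ht =>
    hflow.mem_of_convex (convex_convexHull ℝ _) le_rfl ht (by rw [hz0]; exact hz₀)
  refine ⟨z, ⟨hzc, fun t ht => ne_zero_of_mem_hullPower hw (hmem t ht), fun t ht i => ?_⟩, hz0⟩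
  refine (hzd t ht i).congr_deriv (Finset.sum_congr rfl fun j _ => ?_)
  rw [hbeq i j (hmem t ht), liftedWeight]

lemma PiLp.norm_le_card_mul {ι : Type*} [Fintype ι] {E : ι → Type*}
    [∀ i, SeminormedAddCommGroup (E i)] (x : PiLp 2 E) {ε : ℝ} (h : ∀ i, ‖x i‖ ≤ ε) :
    ‖x‖ ≤ Fintype.card ι * ε := by
  rcases isEmpty_or_nonempty ι with hι | ⟨⟨i₀⟩⟩
  · rw [Subsingleton.elim x 0]; simp
  have hε : 0 ≤ ε := (norm_nonneg _).trans (h i₀)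
  have hcard : (1 : ℝ) ≤ Fintype.card ι := by exact_mod_cast Fintype.card_pos_iff.2 ⟨i₀⟩
  refine le_of_sq_le_sq ?_ (by positivity)
  rw [PiLp.norm_sq_eq_of_L2]
  calc ∑ i, ‖x i‖ ^ 2 ≤ ∑ _i : ι, ε ^ 2 :=
        Finset.sum_le_sum fun i _ => pow_le_pow_left₀ (norm_nonneg _) (h i) 2
    _ = Fintype.card ι * ε ^ 2 := by simp
    _ ≤ (Fintype.card ι * ε) ^ 2 := by nlinarith [sq_nonneg ε]

lemma infDist_consensusSet_le {z : StateSpace n d} {p : Rd d} (hp : p ∈ hull w) {ε : ℝ}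
    (h : ∀ i, ‖z i - p‖ ≤ ε) : Metric.infDist z (consensusSet w) ≤ n * ε := by
  have hmem : (WithLp.toLp 2 fun _ => p : StateSpace n d) ∈ consensusSet w :=
    ⟨fun _ => hp, fun _ _ => rfl⟩
  refine (Metric.infDist_le_dist_of_mem hmem).trans ?_
  rw [dist_eq_norm]
  exact (PiLp.norm_le_card_mul (z - WithLp.toLp 2 fun _ => p) h).trans_eq
    (by rw [Fintype.card_fin])

/-- The components come together within a time that does not depend on the solution. The scalar
result is applied to each coordinate: nodes whose `k`-th coordinates differ by `η` are at least `η`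
apart, so that the weights are nondegenerate in the sense needed there. -/
lemma exists_time_component_dist_le
    (hf_lip : ∀ i j, ∃ K, LipschitzWith K (f i j))
    (hf_pos : ∀ i j s, 0 < s → 0 < f i j s)
    (hN : HasDwellTime N)
    (hconn : UniformlyQuasiStronglyConnected N) (hw : (0 : Rd d) ∉ hull w)
    (hf_zero : (∃ a ∈ hull w, ∃ b ∈ hull w, a ≠ b ∧ SameRay ℝ a b) → ∀ i j, i ≠ j → 0 < f i j 0)
    {ε : ℝ} (hε : 0 < ε) :
    ∃ T > 0, ∀ z, IsLiftedSolution f N z → z 0 ∈ hullPower w → ∀ i j,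
      ‖z T i - z T j‖ ≤ ε := by
  obtain ⟨C, hC0, hC⟩ := exists_liftedWeight_le hf_lip hw
  choose! c hc0 hc using fun η (hη : 0 < η) =>
    exists_le_liftedWeight hf_lip hf_pos hw hf_zero hη
  obtain ⟨D, hD⟩ := (isCompact_hull w).isBounded.exists_norm_le
  have hd : (0 : ℝ) < d + 1 := by positivity
  obtain ⟨T, hT, hspread⟩ := exists_time_spread_le hC0 hc0 hN hconn (div_pos hε hd) D
  refine ⟨T, hT, fun z hz hz0 i j => ?_⟩
  have hmem := forwardInvariant_hullPower hf_lip hf_pos w z hz hz0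
  have hcoord : ∀ k, |z T i k - z T j k| ≤ ε / (d + 1) := by
    intro k
    have hflow : IsNondegenerateFlow N C c (fun i j t => liftedWeight f i j (z t))
        (fun i t => z t i k) :=
      { toIsAveragingFlow := (hz.isAveragingFlow hf_lip hf_pos).map (EuclideanSpace.proj k)
        le_bound := fun i j t ht => hC i j _ (hmem t ht)
        lower := fun η hη i j t ht hd => hc η hη i j _ (hmem t ht)
          (hd.trans (PiLp.norm_apply_le (z t j - z t i) k)) }
    exact hspread hflow (fun i => abs_le.1
      ((PiLp.norm_apply_le (z 0 i) k).trans (hD _ (hz0 i)))) i j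
  refine (PiLp.norm_le_card_mul (z T i - z T j) hcoord).trans ?_
  rw [Fintype.card_fin, mul_div_assoc', div_le_iff₀ hd]
  nlinarith

end Solutions

theorem proposition7 {n d : ℕ}
    (f : Fin n → Fin n → ℝ → ℝ)
    (hf_lip : ∀ i j, ∃ K, LipschitzWith K (f i j))
    (hf_pos : ∀ i j s, 0 < s → 0 < f i j s)
    (N : Fin n → ℝ → Finset (Fin n))
    (hN : HasDwellTime N)
    (hconn : UniformlyQuasiStronglyConnected N)
    (w : StateSpace n d)
    (hw : (0 : Rd d) ∉ hull w)
    (hf_zero : (∃ a ∈ hull w, ∃ b ∈ hull w, a ≠ b ∧ SameRay ℝ a b) →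
      ∀ i j, i ≠ j → 0 < f i j 0) :
    (∀ z₀ ∈ hullPower w, ∃ z : ℝ → StateSpace n d, IsLiftedSolution f N z ∧ z 0 = z₀) ∧
    GloballyUniformlyAsymptoticallyStable (IsLiftedSolution f N) (consensusSet w)
      (hullPower w) ∧
    ∀ z : ℝ → StateSpace n d, IsLiftedSolution f N z → z 0 ∈ hullPower w →
      ∃ zbar : Rd d, ∀ i, Tendsto (fun t => z t i) atTop (𝓝 zbar) := by
  -- connectivity provides a node
  obtain ⟨r, -⟩ := hconn.choose_spec.2 0
  have hn : (0 : ℝ) < n := Nat.cast_pos.2 (Fin.pos r)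
  have hinv := forwardInvariant_hullPower (N := N) hf_lip hf_pos w
  refine ⟨fun z₀ hz₀ => exists_isLiftedSolution hf_lip hf_pos hN hw hz₀,
    ⟨isCompact_hullPower w, hinv, fun ε hε => ?_, fun ε hε => ?_⟩, fun z hz hz0 => ?_⟩
  · obtain ⟨T, hT, hTε⟩ :=
      exists_time_component_dist_le hf_lip hf_pos hN hconn hw hf_zero (div_pos hε hn)
    refine ⟨T, hT, fun z hz hz0 => ?_⟩
    refine (infDist_consensusSet_le (hinv z hz hz0 T hT.le r)
      fun i => hTε z hz hz0 i r).trans_eq ?_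
    field_simp
  · -- balls around a consensus value are convex, hence no component leaves them
    refine ⟨ε / (2 * n), by positivity, fun z hz hz0 hdist t ht => ?_⟩
    have hne : (consensusSet w).Nonempty :=
      ⟨WithLp.toLp 2 fun _ => w r, fun _ => subset_convexHull ℝ _ (mem_range_self r),
        fun _ _ => rfl⟩
    obtain ⟨a, ha, hza⟩ := (Metric.infDist_lt_iff hne).1
      (hdist.trans_lt (show ε / (2 * n) < ε / n from
        div_lt_div_of_pos_left hε hn (by linarith)))
    have hball : ∀ i, z t i ∈ Metric.closedBall (a r) (ε / n) :=
      (hz.isAveragingFlow hf_lip hf_pos).mem_of_convex (convex_closedBall _ _) le_rfl ht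
        fun i => by
          rw [ha.2 r i, Metric.mem_closedBall, dist_eq_norm]
          rw [dist_eq_norm] at hza
          exact (PiLp.norm_apply_le (z 0 - a) i).trans hza.le
    refine (infDist_consensusSet_le (ha.1 r) fun i => ?_).trans_eq
      (show n * (ε / n) = ε by field_simp)
    simpa [dist_eq_norm] using hball i
  · have hclose : ∀ ε > 0, ∃ T, ∀ t ≥ T, ∀ i, dist (z t i) (z T r) ≤ ε := fun ε hε => by
      obtain ⟨T, hT, hTε⟩ :=
        exists_time_component_dist_le hf_lip hf_pos hN hconn hw hf_zero hε
      refine ⟨T, fun t ht i => ?_⟩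
      exact (hz.isAveragingFlow hf_lip hf_pos).mem_of_convex (convex_closedBall (z T r) ε)
        hT.le ht (fun i => by
          rw [Metric.mem_closedBall, dist_eq_norm]; exact hTε z hz hz0 i r) i
    have hcauchy : CauchySeq fun t => z t r := Metric.cauchySeq_iff'.2 fun ε hε => by
      obtain ⟨T, hT⟩ := hclose (ε / 2) (by positivity)
      exact ⟨T, fun t ht => (hT t ht r).trans_lt (by linarith)⟩
    obtain ⟨zbar, hzbar⟩ := cauchySeq_tendsto_of_complete hcauchy
    refine ⟨zbar, fun i => Metric.tendsto_atTop.2 fun ε hε => ?_⟩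
    obtain ⟨T, hT⟩ := hclose (ε / 3) (by positivity)
    have hlim : dist zbar (z T r) ≤ ε / 3 := le_of_tendsto (hzbar.dist tendsto_const_nhds)
      ((eventually_ge_atTop T).mono fun t ht => hT t ht r)
    refine ⟨T, fun t ht => ?_⟩
    have := dist_triangle_right (z t i) zbar (z T r)
    linarith [hT t ht i]
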